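/- Let $G$ be an abelian group and let $A, B \subseteq G$ be finite subsets with $|A| \ge 2$ and $|B| \ge 2$. For $i \ge 1$ let $A +_i B$ denote the set of all $g \in G$ that have at least $i$ representations of the form $g = a + b$ with $a \in A$ and $b \in B$. Then either $$|A +_1 B| + |A +_2 B| \ge 2|A| + 2|B| - 4,$$ or there exist a subgroup $H \le G$ with $|H| \ge 3$ and an element $x \in G$ such that $x + H \subseteq A +_2 B$. -/

import Mathlib

open scoped Pointwise

/-- The set `A +ᵢ B` of `i`-representable sums: all `g` having at least `i` representations
`g = a + b` with `a ∈ A` and `b ∈ B`. -/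
def representableSums {G : Type*} [AddCommGroup G] [DecidableEq G]
    (i : ℕ) (A B : Finset G) : Set G :=
  {g : G | i ≤ A.addConvolution B g}

/-- For `i ≥ 1` the set of `i`-representable sums is finite, so `Set.ncard` is its cardinality. -/
theorem representableSums_finite {G : Type*} [AddCommGroup G] [DecidableEq G]
    {i : ℕ} (hi : 1 ≤ i) (A B : Finset G) : (representableSums i A B).Finite := by
  refine (A + B).finite_toSet.subset fun g hg => ?_
  have h : 0 < A.addConvolution B g := lt_of_lt_of_le hi hg
  obtain ⟨p, hp⟩ := Finset.card_pos.mp h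
  simp only [Finset.mem_filter, Finset.mem_product] at hp
  exact Finset.mem_coe.mpr (Finset.mem_add.mpr ⟨p.1, hp.1.1, p.2, hp.1.2, hp.2⟩)

/-! Induction on `|B|`. If some translate `e + B` meets `A` in at least two points without lying in
`A`, the Dyson transform keeps `|A| + |B|`, shrinks `B` to a set of size at least 2 and creates no
new sums (`representableSums_dyson_subset`). Otherwise `representableSums_of_translates` applies:
either `A` is stable under `B - B`, or some translate of `B` meets `A` in a single point `x = e +
b₀`. Deleting `x` from `A` and `b₀` from `B` then yields either two large sets of sums whose overlap
is doubly represented, or enough translates inside `A` to force a stable set, hence a coset. -/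

theorem mem_representableSums_one {G : Type*} [AddCommGroup G] [DecidableEq G]
    {A B : Finset G} {g : G} :
    g ∈ representableSums 1 A B ↔ ∃ a ∈ A, ∃ b ∈ B, a + b = g := by
  change 0 < (Finset.card _) ↔ _
  simp only [Finset.card_pos, Finset.Nonempty, Finset.mem_filter, Finset.mem_product, Prod.exists]
  grind

theorem mem_representableSums_two {G : Type*} [AddCommGroup G] [DecidableEq G]
    {A B : Finset G} {g : G} :
    g ∈ representableSums 2 A B ↔
      ∃ a ∈ A, ∃ b ∈ B, ∃ a' ∈ A, ∃ b' ∈ B, a + b = g ∧ a' + b' = g ∧ a ≠ a' := by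
  change 1 < (Finset.card _) ↔ _
  simp only [Finset.one_lt_card, Finset.mem_filter, Finset.mem_product, Prod.exists]
  constructor
  · rintro ⟨a, b, ⟨⟨ha, hb⟩, h⟩, a', b', ⟨⟨ha', hb'⟩, h'⟩, hne⟩
    refine ⟨a, ha, b, hb, a', ha', b', hb', h, h', ?_⟩
    rintro rfl
    exact hne (by rw [add_left_cancel (h.trans h'.symm)])
  · rintro ⟨a, ha, b, hb, a', ha', b', hb', h, h', hne⟩
    exact ⟨a, b, ⟨⟨ha, hb⟩, h⟩, a', b', ⟨⟨ha', hb'⟩, h'⟩, fun h => hne (congrArg Prod.fst h)⟩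

/-- Two finite sets of sums whose common elements have two representations. -/
theorem card_add_card_le_ncard_representableSums {G : Type*} [AddCommGroup G] [DecidableEq G]
    {A B X Y : Finset G} (h₁ : ∀ g ∈ X ∪ Y, g ∈ representableSums 1 A B)
    (h₂ : ∀ g ∈ X ∩ Y, g ∈ representableSums 2 A B) :
    X.card + Y.card ≤ (representableSums 1 A B).ncard + (representableSums 2 A B).ncard := by
  rw [← Finset.card_union_add_card_inter, ← Set.ncard_coe_finset, ← Set.ncard_coe_finset]
  exact add_le_add
    (Set.ncard_le_ncard h₁ (representableSums_finite le_rfl A B))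
    (Set.ncard_le_ncard h₂ (representableSums_finite one_le_two A B))

/-- If `A` contains a nonempty set stable under all differences `b - b₁`, then `A +₂ B` contains a
coset of a subgroup with at least `|B|` elements. -/
theorem exists_coset_subset_representableSums_two {G : Type*} [AddCommGroup G] [DecidableEq G]
    {A B T : Finset G} (hTA : T ⊆ A) (hT : T.Nonempty) (hB : 3 ≤ B.card) {b₁ : G} (hb₁ : b₁ ∈ B)
    (hstable : ∀ b ∈ B, ∀ t ∈ T, t + (b - b₁) ∈ T) :
    ∃ (H : AddSubgroup G) (x : G),
      3 ≤ Nat.card H ∧ x +ᵥ (H : Set G) ⊆ representableSums 2 A B := by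
  obtain ⟨t, ht⟩ := hT
  let H : AddSubgroup G := AddAction.stabilizer G T
  have mem_of_mem : ∀ {m : G}, m ∈ H → ∀ {s : G}, s ∈ T → m + s ∈ T := by
    intro m hm s hs
    have h : m +ᵥ T = T := hm
    rw [← h]
    exact Finset.vadd_mem_vadd_finset hs
  have hBH : ∀ b ∈ B, b - b₁ ∈ H := by
    intro b hb
    change (b - b₁) +ᵥ T = T
    refine Finset.eq_of_subset_of_card_le ?_ (Finset.card_vadd_finset _ _).ge
    intro g hg
    obtain ⟨s, hs, rfl⟩ := Finset.mem_vadd_finset.mp hg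
    rw [vadd_eq_add, add_comm (b - b₁)]
    exact hstable b hb s hs
  have : Finite H := Finite.of_injective
    (fun m : H => (⟨m.1 + t, mem_of_mem m.2 ht⟩ : T)) (by
      intro m m' h
      exact Subtype.ext (add_right_cancel (congrArg Subtype.val h)))
  refine ⟨H, t + b₁, ?_, ?_⟩
  · have h := Nat.card_le_card_of_injective
      (fun b : B => (⟨b.1 - b₁, hBH b.1 b.2⟩ : H)) (by
        intro b b' h
        exact Subtype.ext (sub_left_injective (congrArg Subtype.val h)))
    rw [Nat.card_eq_fintype_card, Fintype.card_coe] at h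
    exact hB.trans h
  · intro g hg
    obtain ⟨m, hm, rfl⟩ := hg
    obtain ⟨b₂, hb₂, hne⟩ := Finset.exists_mem_ne (by omega : 1 < B.card) b₁
    -- Trading `b₁` for `b₂` shifts the other summand by an element of `H`, so it stays in `T`.
    refine mem_representableSums_two.mpr ⟨m + t, hTA (mem_of_mem hm ht), b₁, hb₁,
      (m - (b₂ - b₁)) + t, hTA (mem_of_mem (H.sub_mem hm (hBH b₂ hb₂)) ht), b₂, hb₂, ?_, ?_, ?_⟩
    · simp only [vadd_eq_add]; abel
    · simp only [vadd_eq_add]; abel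
    · intro h
      have h' := add_right_cancel h
      rw [eq_comm, sub_eq_self, sub_eq_zero] at h'
      exact hne h'

/-- The Dyson transform of `(A, B)` at `e` only has sums that were represented at least as often. -/
theorem representableSums_dyson_subset {G : Type*} [AddCommGroup G] [DecidableEq G]
    (A B : Finset G) (e : G) :
    representableSums 1 (A ∪ (e +ᵥ B)) {b ∈ B | e + b ∈ A} ⊆ representableSums 1 A B ∧
    representableSums 2 (A ∪ (e +ᵥ B)) {b ∈ B | e + b ∈ A} ⊆ representableSums 2 A B := by
  -- A sum `(e + b) + i` is rewritten as `(e + i) + b`. Recording `u ∉ A` keeps two rewritten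
  -- representations distinct.
  have key : ∀ u ∈ A ∪ (e +ᵥ B), u ∈ A ∨ u ∉ A ∧ ∃ b ∈ B, u = e + b := by
    intro u hu
    by_cases h : u ∈ A
    · exact Or.inl h
    · rcases Finset.mem_union.mp hu with hu | hu
      · exact absurd hu h
      · obtain ⟨b, hb, rfl⟩ := Finset.mem_vadd_finset.mp hu
        exact Or.inr ⟨h, b, hb, rfl⟩
  constructor
  · intro g hg
    obtain ⟨u, hu, i, hi, rfl⟩ := mem_representableSums_one.mp hg
    obtain ⟨hiB, hiA⟩ := Finset.mem_filter.mp hi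
    rw [mem_representableSums_one]
    rcases key u hu with hu | ⟨-, b, hb, rfl⟩
    · exact ⟨u, hu, i, hiB, rfl⟩
    · exact ⟨e + i, hiA, b, hb, by abel⟩
  · intro g hg
    obtain ⟨u, hu, i, hi, v, hv, j, hj, rfl, hs, hne⟩ := mem_representableSums_two.mp hg
    obtain ⟨hiB, hiA⟩ := Finset.mem_filter.mp hi
    obtain ⟨hjB, hjA⟩ := Finset.mem_filter.mp hj
    rw [mem_representableSums_two]
    rcases key u hu with hu | ⟨hu, b, hb, rfl⟩ <;> rcases key v hv with hv | ⟨hv, c, hc, rfl⟩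
    · exact ⟨u, hu, i, hiB, v, hv, j, hjB, rfl, hs, hne⟩
    · refine ⟨u, hu, i, hiB, e + j, hjA, c, hc, rfl, by rw [← hs]; abel, ?_⟩
      rintro rfl
      have : c = i := by
        have : e + j + c = e + j + i := by rw [← hs]; abel
        exact add_left_cancel this
      exact hv (this ▸ hiA)
    · refine ⟨e + i, hiA, b, hb, v, hv, j, hjB, by abel, hs, ?_⟩
      rintro rfl
      have : b = j := by
        have : e + i + b = e + i + j := by rw [hs]; abel
        exact add_left_cancel this
      exact hu (this ▸ hjA)
    · refine ⟨e + i, hiA, b, hb, e + j, hjA, c, hc, by abel, by rw [← hs]; abel, ?_⟩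
      intro h
      rw [add_left_cancel h] at hs
      exact hne (add_right_cancel hs).symm

/-- An injective self-map of a finite set is onto. -/
theorem sub_mem_of_forall_add_mem {G : Type*} [AddCommGroup G] [DecidableEq G]
    {T : Finset G} {f : G} (h : ∀ a ∈ T, a + f ∈ T) {a : G} (ha : a ∈ T) : a - f ∈ T := by
  have hT : f +ᵥ T = T := by
    refine Finset.eq_of_subset_of_card_le ?_ (Finset.card_vadd_finset _ _).ge
    intro g hg
    obtain ⟨s, hs, rfl⟩ := Finset.mem_vadd_finset.mp hg
    rw [vadd_eq_add, add_comm f]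
    exact h s hs
  rw [← hT] at ha
  obtain ⟨s, hs, rfl⟩ := Finset.mem_vadd_finset.mp ha
  simpa [vadd_eq_add] using hs

/-- The case in which every translate of `B` lies in `A` or meets `A` in at most one point. -/
theorem representableSums_of_translates {G : Type*} [AddCommGroup G] [DecidableEq G]
    {A B : Finset G} (hA : 2 ≤ A.card) (hB : 3 ≤ B.card)
    (hAB : ∀ e, ∀ b ∈ B, ∀ b' ∈ B, b ≠ b' → e + b ∈ A → e + b' ∈ A → ∀ c ∈ B, e + c ∈ A) :
    2 * A.card + 2 * B.card ≤
        (representableSums 1 A B).ncard + (representableSums 2 A B).ncard + 4 ∨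
      ∃ (H : AddSubgroup G) (x : G),
        3 ≤ Nat.card H ∧ x +ᵥ (H : Set G) ⊆ representableSums 2 A B := by
  by_cases hper : ∀ e, ∀ b ∈ B, e + b ∈ A → ∀ c ∈ B, e + c ∈ A
  · right
    obtain ⟨b₁, hb₁⟩ := Finset.card_pos.mp (by omega : 0 < B.card)
    refine exists_coset_subset_representableSums_two (Finset.Subset.refl A)
      (Finset.card_pos.mp (by omega)) hB hb₁ fun b hb t ht => ?_
    have := hper (t - b₁) b₁ hb₁ (by simpa using ht) b hb
    convert this using 1
    abel
  push Not at hper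
  obtain ⟨e, b₀, hb₀, hx, c₀, hc₀, hc₀A⟩ := hper
  have honly : ∀ b ∈ B, e + b ∈ A → b = b₀ := by
    intro b hb h
    by_contra hne
    exact hc₀A (hAB e b hb b₀ hb₀ hne h hx c₀ hc₀)
  obtain ⟨x, rfl⟩ : ∃ x, x = e + b₀ := ⟨_, rfl⟩
  set x := e + b₀ with hxdef
  set A' := A.erase x with hA'
  set B' := B.erase b₀ with hB'
  have hcardA : A'.card + 1 = A.card := Finset.card_erase_add_one hx
  have hcardB : B'.card + 1 = B.card := Finset.card_erase_add_one hb₀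
  have hxA' : x ∉ A' := Finset.notMem_erase _ _
  have hAA' : ∀ {a}, a ∈ A → a ≠ x → a ∈ A' := fun ha h => Finset.mem_erase.mpr ⟨h, ha⟩
  have hA'A : ∀ {a}, a ∈ A' → a ∈ A := fun ha => Finset.mem_of_mem_erase ha
  have hB'B : ∀ {b}, b ∈ B' → b ∈ B := fun hb => Finset.mem_of_mem_erase hb
  by_cases hone : ∃ a ∈ A', ∃ b ∈ B', ∀ c ∈ B', a - b + c ∈ A' → c = b
  · left
    obtain ⟨a, ha, b, hb, hab⟩ := hone
    have hsum : A.card + B.card ≤ (A' + B').card + 3 := by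
      have hsub : (b +ᵥ A') ∪ (a +ᵥ B') ⊆ A' + B' := by
        intro g hg
        rcases Finset.mem_union.mp hg with hg | hg
        · obtain ⟨s, hs, rfl⟩ := Finset.mem_vadd_finset.mp hg
          exact Finset.mem_add.mpr ⟨s, hs, b, hb, add_comm _ _⟩
        · obtain ⟨s, hs, rfl⟩ := Finset.mem_vadd_finset.mp hg
          exact Finset.mem_add.mpr ⟨a, ha, s, hs, rfl⟩
      have hinter : (b +ᵥ A') ∩ (a +ᵥ B') ⊆ {a + b} := by
        intro g hg
        obtain ⟨hg₁, hg₂⟩ := Finset.mem_inter.mp hg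
        obtain ⟨s, hs, rfl⟩ := Finset.mem_vadd_finset.mp hg₁
        obtain ⟨c, hc, h⟩ := Finset.mem_vadd_finset.mp hg₂
        simp only [vadd_eq_add] at h
        have : a - b + c = s := by
          rw [sub_add_eq_add_sub, h]; abel
        have hcb := hab c hc (this ▸ hs)
        rw [Finset.mem_singleton, vadd_eq_add, ← h, hcb]
      have h₁ := Finset.card_le_card hsub
      have h₂ := Finset.card_le_card hinter
      have h₃ := Finset.card_union_add_card_inter (b +ᵥ A') (a +ᵥ B')
      rw [Finset.card_vadd_finset, Finset.card_vadd_finset] at h₃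
      rw [Finset.card_singleton] at h₂
      omega
    have hU : A.card + B.card ≤ (A ∪ (e +ᵥ B)).card + 1 := by
      have hinter : A ∩ (e +ᵥ B) ⊆ {x} := by
        intro g hg
        obtain ⟨hg₁, hg₂⟩ := Finset.mem_inter.mp hg
        obtain ⟨s, hs, rfl⟩ := Finset.mem_vadd_finset.mp hg₂
        rw [Finset.mem_singleton, vadd_eq_add, honly s hs hg₁]
      have h₂ := Finset.card_le_card hinter
      have h₃ := Finset.card_union_add_card_inter A (e +ᵥ B)
      rw [Finset.card_vadd_finset] at h₃
      rw [Finset.card_singleton] at h₂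
      omega
    have hrep : ∀ g ∈ b₀ +ᵥ (A ∪ (e +ᵥ B)),
        ∃ s ∈ A, ∃ c ∈ B, s + c = g ∧ (s = x ∨ c = b₀) := by
      intro g hg
      obtain ⟨u, hu, rfl⟩ := Finset.mem_vadd_finset.mp hg
      rcases Finset.mem_union.mp hu with hu | hu
      · exact ⟨u, hu, b₀, hb₀, add_comm _ _, Or.inr rfl⟩
      · obtain ⟨c, hc, rfl⟩ := Finset.mem_vadd_finset.mp hu
        refine ⟨x, hx, c, hc, ?_, Or.inl rfl⟩
        simp only [vadd_eq_add, hxdef]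
        abel
    -- `X` is `(A + b₀) ∪ (x + B)`: its sums have a representation using `x` or `b₀`, those of `Y`
    -- one using neither, so common sums have two. The sizes are at least `|A| + |B| - 1` and `|A| +
    -- |B| - 3`.
    have h := card_add_card_le_ncard_representableSums (A := A) (B := B)
      (X := b₀ +ᵥ (A ∪ (e +ᵥ B))) (Y := A' + B') (by
        intro g hg
        rw [mem_representableSums_one]
        rcases Finset.mem_union.mp hg with hg | hg
        · obtain ⟨s, hs, c, hc, h, -⟩ := hrep g hg
          exact ⟨s, hs, c, hc, h⟩
        · obtain ⟨s, hs, c, hc, h⟩ := Finset.mem_add.mp hg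
          exact ⟨s, hA'A hs, c, hB'B hc, h⟩) (by
        intro g hg
        rw [mem_representableSums_two]
        obtain ⟨hg₁, hg₂⟩ := Finset.mem_inter.mp hg
        obtain ⟨s, hs, c, hc, h, hsc⟩ := hrep g hg₁
        obtain ⟨s', hs', c', hc', h'⟩ := Finset.mem_add.mp hg₂
        refine ⟨s, hs, c, hc, s', hA'A hs', c', hB'B hc', h, h', ?_⟩
        rintro rfl
        rcases hsc with rfl | rfl
        · exact hxA' hs'
        · exact Finset.ne_of_mem_erase hc' (add_left_cancel (h'.trans h.symm)))
    rw [Finset.card_vadd_finset] at h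
    omega
  right
  push Not at hone
  have hmove : ∀ a ∈ A', ∀ b ∈ B', ∀ c ∈ B, a - b + c ∈ A := by
    intro a ha b hb
    obtain ⟨c, hc, hcA, hne⟩ := hone a ha b hb
    exact hAB (a - b) c (hB'B hc) b (hB'B hb) hne (hA'A hcA) (by simpa using hA'A ha)
  obtain ⟨b₁, hb₁, b₂, hb₂, hne⟩ := Finset.one_lt_card.mp (by omega : 1 < B'.card)
  by_cases hstab : ∀ a ∈ A', a + (b₁ - b₂) ∈ A'
  · refine exists_coset_subset_representableSums_two (T := A') (fun _ => hA'A)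
      (Finset.card_pos.mp (by omega)) hB (hB'B hb₁) fun b hb t ht => ?_
    have hmem := hmove t ht b₁ hb₁ b hb
    have heq' : t - b₁ + b = t + (b - b₁) := by abel
    rw [heq'] at hmem
    -- If the move landed on `x`, moving `t + (b₁ - b₂)` instead would put `x + (b₁ - b₂)` in `A'`,
    -- and stability would pull `x` back into `A'`.
    refine hAA' hmem fun heq => ?_
    have h₁ := hmove _ (hstab t ht) b₁ hb₁ b hb
    have h₂ : t + (b₁ - b₂) - b₁ + b = x + (b₁ - b₂) := by rw [← heq]; abel
    rw [h₂] at h₁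
    have h₃ : x + (b₁ - b₂) ∈ A' :=
      hAA' h₁ (by rwa [Ne, add_eq_left, sub_eq_zero])
    have h₄ := sub_mem_of_forall_add_mem hstab h₃
    rw [add_sub_cancel_right] at h₄
    exact hxA' h₄
  · push Not at hstab
    obtain ⟨a, ha, haf⟩ := hstab
    have hax : a + (b₁ - b₂) = x := by
      by_contra h
      refine haf (hAA' ?_ h)
      convert hmove a ha b₂ hb₂ b₁ (hB'B hb₁) using 1
      abel
    -- Now all of `A` is stable; `x`, to which `hmove` does not apply, is handled by a detour
    -- through `x - (b₂ - b₁) ∈ A'`.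
    have hsub : ∀ s ∈ A, s + (b₂ - b₁) ∈ A := by
      intro s hs
      by_cases hsx : s = x
      · rw [hsx, ← hax]
        convert hA'A ha using 1
        abel
      · convert hmove s (hAA' hs hsx) b₁ hb₁ b₂ (hB'B hb₂) using 1
        abel
    have hxf : x - (b₂ - b₁) ∈ A' :=
      hAA' (sub_mem_of_forall_add_mem hsub hx)
        (by rw [Ne, sub_eq_self, sub_eq_zero]; exact hne.symm)
    refine exists_coset_subset_representableSums_two (Finset.Subset.refl A)
      (Finset.card_pos.mp (by omega)) hB (hB'B hb₁) fun b hb t ht => ?_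
    by_cases htx : t = x
    · convert hsub _ (hmove _ hxf b₁ hb₁ b hb) using 1
      rw [htx]
      abel
    · convert hmove t (hAA' ht htx) b₁ hb₁ b hb using 1
      abel

/-- The bound `|A +₁ B| + |A +₂ B| ≥ 2|A|` when `B` has two elements. -/
theorem two_mul_card_le_of_card_eq_two {G : Type*} [AddCommGroup G] [DecidableEq G]
    {A B : Finset G} (hB : B.card = 2) :
    2 * A.card ≤ (representableSums 1 A B).ncard + (representableSums 2 A B).ncard := by
  obtain ⟨b, b', hne, rfl⟩ := Finset.card_eq_two.mp hB
  have h := card_add_card_le_ncard_representableSums (A := A) (B := {b, b'})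
    (X := b +ᵥ A) (Y := b' +ᵥ A) (by
      intro g hg
      rw [mem_representableSums_one]
      rcases Finset.mem_union.mp hg with hg | hg
      · obtain ⟨a, ha, rfl⟩ := Finset.mem_vadd_finset.mp hg
        exact ⟨a, ha, b, by simp, add_comm _ _⟩
      · obtain ⟨a, ha, rfl⟩ := Finset.mem_vadd_finset.mp hg
        exact ⟨a, ha, b', by simp, add_comm _ _⟩) (by
      intro g hg
      rw [mem_representableSums_two]
      obtain ⟨hg₁, hg₂⟩ := Finset.mem_inter.mp hg
      obtain ⟨a, ha, rfl⟩ := Finset.mem_vadd_finset.mp hg₁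
      obtain ⟨a', ha', h⟩ := Finset.mem_vadd_finset.mp hg₂
      refine ⟨a, ha, b, by simp, a', ha', b', by simp, add_comm _ _,
        by rw [← h]; exact add_comm _ _, ?_⟩
      rintro rfl
      exact hne (add_right_cancel h).symm)
  rw [Finset.card_vadd_finset, Finset.card_vadd_finset] at h
  omega

theorem representableSums_bound_or_coset {G : Type*} [AddCommGroup G] [DecidableEq G]
    (A B : Finset G) (hA : 2 ≤ A.card) (hB : 2 ≤ B.card) :
    2 * A.card + 2 * B.card ≤
        (representableSums 1 A B).ncard + (representableSums 2 A B).ncard + 4 ∨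
      ∃ (H : AddSubgroup G) (x : G),
        3 ≤ Nat.card H ∧ x +ᵥ (H : Set G) ⊆ representableSums 2 A B := by
  induction hn : B.card using Nat.strong_induction_on generalizing A B with
  | _ n ih =>
  subst hn
  rcases hB.eq_or_lt with hB2 | hB3
  · left
    have := two_mul_card_le_of_card_eq_two (A := A) hB2.symm
    omega
  by_cases hAB : ∀ e, ∀ b ∈ B, ∀ b' ∈ B, b ≠ b' → e + b ∈ A → e + b' ∈ A → ∀ c ∈ B, e + c ∈ A
  · exact representableSums_of_translates hA hB3 hAB
  push Not at hAB
  obtain ⟨e, b, hb, b', hb', hne, hbA, hb'A, c, hc, hcA⟩ := hAB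
  obtain ⟨hsub₁, hsub₂⟩ := representableSums_dyson_subset A B e
  set I := {b ∈ B | e + b ∈ A} with hI
  set U := A ∪ (e +ᵥ B) with hU
  have hI2 : 2 ≤ I.card :=
    Finset.one_lt_card.mpr ⟨b, Finset.mem_filter.mpr ⟨hb, hbA⟩, b',
      Finset.mem_filter.mpr ⟨hb', hb'A⟩, hne⟩
  have hIB : I.card < B.card :=
    Finset.card_lt_card (Finset.filter_ssubset.mpr ⟨c, hc, hcA⟩)
  have hUA : A.card ≤ U.card := Finset.card_le_card Finset.subset_union_left
  have hUI : U.card + I.card = A.card + B.card := by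
    have h : A ∩ (e +ᵥ B) = e +ᵥ I := by
      ext g
      simp only [hI, Finset.mem_inter, Finset.mem_vadd_finset, Finset.mem_filter, vadd_eq_add]
      constructor
      · rintro ⟨hg, s, hs, rfl⟩
        exact ⟨s, ⟨hs, hg⟩, rfl⟩
      · rintro ⟨s, ⟨hs, hg⟩, rfl⟩
        exact ⟨hg, s, hs, rfl⟩
    have := Finset.card_union_add_card_inter A (e +ᵥ B)
    rwa [h, Finset.card_vadd_finset, Finset.card_vadd_finset] at this
  rcases ih I.card hIB U I (hA.trans hUA) hI2 rfl with h | ⟨H, x, hH, hx⟩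
  · left
    have h₁ := Set.ncard_le_ncard hsub₁ (representableSums_finite le_rfl A B)
    have h₂ := Set.ncard_le_ncard hsub₂ (representableSums_finite one_le_two A B)
    omega
  · exact Or.inr ⟨H, x, hH, hx.trans hsub₂⟩

theorem corollary1 {G : Type*} [AddCommGroup G] [DecidableEq G] (A B : Finset G)
    (hA : 2 ≤ A.card) (hB : 2 ≤ B.card) :
    ((representableSums 1 A B).ncard : ℤ) + ((representableSums 2 A B).ncard : ℤ)
        ≥ 2 * (A.card : ℤ) + 2 * (B.card : ℤ) - 4 ∨
      ∃ (H : AddSubgroup G) (x : G),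
        3 ≤ Nat.card H ∧ x +ᵥ (H : Set G) ⊆ representableSums 2 A B := by
  rcases representableSums_bound_or_coset A B hA hB with h | h
  · exact Or.inl (by omega)
  · exact Or.inr h
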